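/- Let $\mathbb D$ be the open unit disk, let $0<\alpha<\pi/2$, and put $$\varphi_\alpha(z)=\tfrac12\sin^2\alpha\,\log\frac{1+z}{1-z}+\frac{z\cos^2\alpha}{1+z^2},\qquad z\in\mathbb D,$$ with the principal branch of the logarithm. Call a domain (nonempty, open and connected set) $\Omega\subset\mathbb C$ convex in the horizontal direction (CHD) if its intersection with each horizontal line is connected or empty. (a) $\varphi_\alpha$ is analytic in $\mathbb D$ and maps $\mathbb D$ univalently onto $\mathbb C$ minus the four half-lines $$\Big\{x\pm\tfrac{\pi\sin^2\alpha}{4}i:\ x\le -x_\alpha\Big\},\qquad \Big\{x\pm\tfrac{\pi\sin^2\alpha}{4}i:\ x\ge x_\alpha\Big\},\qquad x_\alpha=\tfrac12\sin^2\alpha\,\log\cot\tfrac{\alpha}{2}+\tfrac{\cos\alpha}{2},$$ and this image is a CHD domain. (b) Let $n\ge1$ be an integer and, for $z\in\mathbb D$, let (integrals along the segment from $0$ to $z$) $$I_1(z)=\int_0^z\frac{d\zeta}{(1-\zeta^2)(1-\zeta^n)},\qquad J_\eta(z)=\int_0^z\frac{d\zeta}{(\zeta-\eta)^2(1-\zeta^n)},\qquad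 I_2=J_{-i},\quad I_3=J_{i}.$$ With $z_k=e^{2\pi i k/n}$, these integrals are explicitly $$I_1(z)=\frac1n\sum_{k=0}^{n-1}a_k(z),\qquad J_\eta(z)=-\frac1n\sum_{k=0}^{n-1}b_{\eta,k}(z)\quad(\eta=\pm i),$$ where, with principal logarithms, $$a_k(z)=\begin{cases}\dfrac{z}{2(1-z)}+\dfrac14\log\dfrac{1+z}{1-z}, & z_k=1,\\[2mm] \dfrac{z}{2(1+z)}+\dfrac14\log\dfrac{1+z}{1-z}, & z_k=-1,\\[2mm] -\dfrac{z_k\log(1-z)}{2(z_k-1)}+\dfrac{z_k\log(1+z)}{2(z_k+1)}+\dfrac{z_k}{z_k^2-1}\log\dfrac{z_k-z}{z_k}, & \text{otherwise,}\end{cases}$$ $$b_{\eta,k}(z)=\begin{cases}-\dfrac{\eta}{2}\left[\dfrac1{(z-\eta)^2}-\dfrac1{\eta^2}\right], & z_k=\eta,\\[2mm] z_k\left\{\dfrac1{\eta-z_k}\left(\dfrac1{\eta-z}-\dfrac1\eta\right)-\dfrac1{(\eta-z_k)^2}\left[\log\dfrac{\eta-z}{\eta}-\log\dfrac{z_k-z}{z_k}\right]\right\},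 & z_k\ne\eta.\end{cases}$$ Put $$h=\sin^2\alpha\,I_1-\frac{\cos^2\alpha}{2}\,(I_2+I_3),\qquad g=h-\varphi_\alpha .$$ Then $f_\alpha=h+\overline g$ is the harmonic shear of $\varphi_\alpha$ with dilatation $\omega(z)=z^n$; that is, $h$ and $g$ are analytic in $\mathbb D$, $h(0)=g(0)=0$, and $h'-g'=\varphi_\alpha'$, $\omega h'-g'=0$ in $\mathbb D$. The function $f_\alpha$ is harmonic in $\mathbb D$ and maps $\mathbb D$ univalently onto a CHD domain. -/

import Mathlib

open Complex

noncomputable section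

namespace NehariShear

/-- The open unit disk in the complex plane. -/
def disk : Set ℂ := Metric.ball (0 : ℂ) 1

/-- A CHD domain: a domain (open, connected, nonempty) whose intersection with each horizontal
line is connected or empty. -/
structure IsCHDDomain (Ω : Set ℂ) : Prop where
  isOpen : IsOpen Ω
  isConnected : IsConnected Ω
  horizontal : ∀ y : ℝ, IsPreconnected (Ω ∩ {w : ℂ | w.im = y})

/-- A CHD mapping of the unit disk: harmonic, univalent, and with a CHD domain as its range. -/
structure IsCHDMapping (f : ℂ → ℂ) : Prop where
  harmonic : InnerProductSpace.HarmonicOnNhd f disk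
  univalent : Set.InjOn f disk
  range : IsCHDDomain (f '' disk)

/-- `h + conj g` is the harmonic shear of `φ` with dilatation `ω`: the functions `h` and `g` are
analytic in the disk, vanish at `0`, and solve `h' - g' = φ'`, `ω h' - g' = 0`. -/
structure IsHarmonicShear (φ ω h g : ℂ → ℂ) : Prop where
  analytic_h : DifferentiableOn ℂ h disk
  analytic_g : DifferentiableOn ℂ g disk
  h_zero : h 0 = 0
  g_zero : g 0 = 0
  shear : ∀ z ∈ disk, deriv h z - deriv g z = deriv φ z
  dilatation : ∀ z ∈ disk, ω z * deriv h z - deriv g z = 0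

/-- The line integral of `F` along the segment from `0` to `z`. -/
def integralFromZero (F : ℂ → ℂ) (z : ℂ) : ℂ := ∫ t in (0 : ℝ)..1, F ((t : ℂ) * z) * z

/-- The conformal mapping `φ_α`. -/
def phi (α : ℝ) (z : ℂ) : ℂ :=
  1 / 2 * (Real.sin α : ℂ) ^ 2 * Complex.log ((1 + z) / (1 - z))
    + z * (Real.cos α : ℂ) ^ 2 / (1 + z ^ 2)

/-- The abscissa of the tips of the two right-hand slits. -/
def slitTip (α : ℝ) : ℝ :=
  1 / 2 * Real.sin α ^ 2 * Real.log (Real.cot (α / 2)) + Real.cos α / 2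

/-- The distance of the slits to the real axis. -/
def slitHeight (α : ℝ) : ℝ := Real.pi * Real.sin α ^ 2 / 4

/-- The horizontal half-line at height `y` from abscissa `a` to the left. -/
def leftHalfLine (a y : ℝ) : Set ℂ := {w : ℂ | w.im = y ∧ w.re ≤ a}

/-- The horizontal half-line at height `y` from abscissa `a` to the right. -/
def rightHalfLine (a y : ℝ) : Set ℂ := {w : ℂ | w.im = y ∧ a ≤ w.re}

/-- The plane minus the four half-lines. -/
def fourSlitDomain (α : ℝ) : Set ℂ :=
  (leftHalfLine (-slitTip α) (slitHeight α) ∪ leftHalfLine (-slitTip α) (-slitHeight α) ∪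
    rightHalfLine (slitTip α) (slitHeight α) ∪ rightHalfLine (slitTip α) (-slitHeight α))ᶜ

/-- `I₁ = ∫₀ᶻ dζ / ((1 - ζ²)(1 - ζⁿ))`. -/
def I₁ (n : ℕ) (z : ℂ) : ℂ :=
  integralFromZero (fun ζ => 1 / ((1 - ζ ^ 2) * (1 - ζ ^ n))) z

/-- `J_η = ∫₀ᶻ dζ / ((ζ - η)²(1 - ζⁿ))`. -/
def J (n : ℕ) (η z : ℂ) : ℂ :=
  integralFromZero (fun ζ => 1 / ((ζ - η) ^ 2 * (1 - ζ ^ n))) z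

/-- `I₂`, with `η = e^{-iγ}` for `γ = π / 2`. -/
def I₂ (n : ℕ) (z : ℂ) : ℂ := J n (-I) z

/-- `I₃`, with `η = e^{iγ}` for `γ = π / 2`. -/
def I₃ (n : ℕ) (z : ℂ) : ℂ := J n I z

/-- The `n`-th roots of unity `z_k = e^{2πik/n}`. -/
def root (n k : ℕ) : ℂ := Complex.exp (2 * Real.pi * I * k / n)

open Classical in
/-- Closed form of `∫₀ᶻ w dζ / ((1 - ζ²)(w - ζ))` for a point `w` of the unit circle. For
`w = root n k` with `k < n`, the case `w = 1` is `k = 0`, and `w = -1` is `2 k = n`. -/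
def I₁Term (w z : ℂ) : ℂ :=
  if w = 1 then
    1 / 2 * (z / (1 - z)) + 1 / 4 * Complex.log ((1 + z) / (1 - z))
  else if w = -1 then
    1 / 2 * (z / (1 + z)) + 1 / 4 * Complex.log ((1 + z) / (1 - z))
  else
    -(w * Complex.log (1 - z) / (2 * (w - 1))) + w * Complex.log (1 + z) / (2 * (w + 1))
      + w / (w ^ 2 - 1) * Complex.log ((w - z) / w)

open Classical in
/-- Closed form of `∫₀ᶻ w dζ / ((ζ - η)²(ζ - w))` for points `w`, `η` of the unit circle. -/
def JTerm (η w z : ℂ) : ℂ :=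
  if w = η then
    -(η / 2 * (1 / (z - η) ^ 2 - 1 / η ^ 2))
  else
    w * (1 / (η - w) * (1 / (η - z) - 1 / η)
      - 1 / (η - w) ^ 2 * (Complex.log ((η - z) / η) - Complex.log ((w - z) / w)))

/-- The explicit value of `I₁`. -/
def I₁Closed (n : ℕ) (z : ℂ) : ℂ :=
  1 / (n : ℂ) * ∑ k ∈ Finset.range n, I₁Term (root n k) z

/-- The explicit value of `J_η`, both when `η` is an `n`-th root of unity and when it is not. -/
def JClosed (n : ℕ) (η z : ℂ) : ℂ :=
  -(1 / (n : ℂ)) * ∑ k ∈ Finset.range n, JTerm η (root n k) z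

/-- The analytic part `h` of the harmonic shear of `φ_α` with dilatation `zⁿ`. -/
def analyticPart (α : ℝ) (n : ℕ) (z : ℂ) : ℂ :=
  (Real.sin α : ℂ) ^ 2 * I₁ n z - (Real.cos α : ℂ) ^ 2 / 2 * (I₂ n z + I₃ n z)

/-- The function `g = h - φ_α`. -/
def coanalyticPart (α : ℝ) (n : ℕ) (z : ℂ) : ℂ := analyticPart α n z - phi α z

/-- The harmonic function `f_α = h + conj g`. -/
def shearMap (α : ℝ) (n : ℕ) (z : ℂ) : ℂ :=
  analyticPart α n z + (starRingEnd ℂ) (coanalyticPart α n z)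

end NehariShear

end

open Filter Topology

noncomputable section

namespace NehariShear

/-! Univalence of `phi`: since (1 + z²)φ' = sin²α (1 + z²)/(1 - z²) + cos²α (1 - z²)/(1 + z²), this
product has positive real part (`re_mul_phiDeriv_pos`). The strip map s satisfies s' = -(i/2)(1 +
s²), so 2i φ∘s has a derivative of positive real part on a convex strip, and Noshiro–Warschawski
applies (`injOn_phi`).

Image of `phi`: on the unit circle away from ±1, ±i, φ extends continuously, and its values fill
exactly the four half-lines; the tips correspond to the points with |Re z| = cos α. Univalence keeps
the values inside the disk off the slits (`phi_mem_fourSlitDomain`), and φ blows up at ±1 and ±i.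
The image is therefore open and relatively closed in the connected slit domain, hence equal to it
(`phi_image_disk`).

Shear: Im(h + conj g) = Im(h - g), so (h + conj g)∘φ⁻¹ moves points only horizontally. On each
horizontal section of the CHD domain, which is an interval, its real part has derivative Re((h' +
g')/(h' - g')) > 0 because |g'| < |h'|. This yields injectivity and horizontal convexity
(`isCHDMapping_of_shear`). Here h' = φ'/(1 - zⁿ) and g' = zⁿh'.

Closed forms: `sum_root_div_sub` splits 1/(1 - zⁿ) over the roots of unity, and each summand has an
elementary primitive vanishing at 0. -/

lemma mem_disk {z : ℂ} : z ∈ disk ↔ ‖z‖ < 1 := by simp [disk]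

lemma isOpen_disk : IsOpen disk := Metric.isOpen_ball

lemma sub_ne_zero_of_mem_disk {w z : ℂ} (hw : ‖w‖ = 1) (hz : z ∈ disk) : w - z ≠ 0 := by
  rw [mem_disk] at hz
  intro h
  rw [sub_eq_zero] at h
  rw [h] at hw
  linarith

lemma one_sub_ne_zero {z : ℂ} (hz : z ∈ disk) : 1 - z ≠ 0 :=
  sub_ne_zero_of_mem_disk (by simp) hz

lemma one_add_ne_zero {z : ℂ} (hz : z ∈ disk) : 1 + z ≠ 0 := by
  have := sub_ne_zero_of_mem_disk (w := -1) (by simp) hz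
  intro h
  exact this (by linear_combination -h)

lemma pow_mem_disk {z : ℂ} (hz : z ∈ disk) {n : ℕ} (hn : 1 ≤ n) : z ^ n ∈ disk := by
  rw [mem_disk] at *
  rw [norm_pow]
  exact pow_lt_one₀ (norm_nonneg _) hz (by omega)

lemma one_sub_sq_ne_zero {z : ℂ} (hz : z ∈ disk) : 1 - z ^ 2 ≠ 0 :=
  one_sub_ne_zero (pow_mem_disk hz (by norm_num))

lemma one_add_sq_ne_zero {z : ℂ} (hz : z ∈ disk) : 1 + z ^ 2 ≠ 0 :=
  one_add_ne_zero (pow_mem_disk hz (by norm_num))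

lemma re_lt_one {z : ℂ} (hz : z ∈ disk) : z.re < 1 :=
  (Complex.re_le_norm z).trans_lt (mem_disk.1 hz)

lemma re_cayley_pos {z : ℂ} (hz : z ∈ disk) : 0 < ((1 + z) / (1 - z)).re := by
  have h1 := one_sub_ne_zero hz
  have h2 : 0 < normSq (1 - z) := normSq_pos.2 h1
  have h3 : ((1 + z) / (1 - z)).re = (1 - normSq z) / normSq (1 - z) := by
    rw [Complex.div_re]
    field_simp
    simp [normSq_apply]
    ring
  rw [h3]
  apply div_pos _ h2
  rw [normSq_eq_norm_sq]
  have := mem_disk.1 hz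
  nlinarith [norm_nonneg z]

lemma mem_slitPlane_of_re_pos {z : ℂ} (hz : 0 < z.re) : z ∈ slitPlane := Or.inl hz

lemma re_div_sub_pos {w z : ℂ} (hw : ‖w‖ = 1) (hz : z ∈ disk) : 0 < ((w - z) / w).re := by
  have hw0 : w ≠ 0 := by rintro rfl; simp at hw
  have : (w - z) / w = 1 - z / w := by field_simp
  have h2 : z / w ∈ disk := by
    rw [mem_disk, norm_div, hw]
    simpa using mem_disk.1 hz
  rw [this, sub_re, one_re]
  linarith [re_lt_one h2]

lemma hasDerivAt_log_div_sub {w z : ℂ} (hw : ‖w‖ = 1) (hz : z ∈ disk) :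
    HasDerivAt (fun z => log ((w - z) / w)) (-(1 / (w - z))) z := by
  have hw0 : w ≠ 0 := by rintro rfl; simp at hw
  have h0 := sub_ne_zero_of_mem_disk hw hz
  have := ((((hasDerivAt_id z).const_sub w).div_const w).clog
    (mem_slitPlane_of_re_pos (re_div_sub_pos hw hz)))
  convert! this using 1
  simp
  field_simp

lemma hasDerivAt_log_cayley {z : ℂ} (hz : z ∈ disk) :
    HasDerivAt (fun z => log ((1 + z) / (1 - z))) (2 / (1 - z ^ 2)) z := by
  have h1 := one_sub_ne_zero hz
  have h2 := one_add_ne_zero hz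
  have h3 := one_sub_sq_ne_zero hz
  have := ((((hasDerivAt_id z).const_add 1).div ((hasDerivAt_id z).const_sub 1) h1).clog
    (mem_slitPlane_of_re_pos (re_cayley_pos hz)))
  convert! this using 1
  simp
  have h4 : 1 - z ^ 2 = (1 - z) * (1 + z) := by ring
  rw [h4]
  field_simp
  ring

/-! ### Explicit primitives by partial fractions over the roots of unity -/

/-- The fundamental theorem of calculus along segments issuing from the origin. -/
lemma integralFromZero_eq {F G : ℂ → ℂ} (hF : ContinuousOn F disk)
    (hG : ∀ z ∈ disk, HasDerivAt G (F z) z) (hG0 : G 0 = 0) {z : ℂ} (hz : z ∈ disk) :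
    integralFromZero F z = G z := by
  have hmem : ∀ t ∈ Set.uIcc (0 : ℝ) 1, (t : ℂ) * z ∈ disk := by
    intro t ht
    rw [Set.uIcc_of_le zero_le_one] at ht
    rw [mem_disk] at *
    rw [norm_mul, norm_real, Real.norm_eq_abs, abs_of_nonneg ht.1]
    nlinarith [norm_nonneg z, ht.2]
  have hd : ∀ t ∈ Set.uIcc (0 : ℝ) 1,
      HasDerivAt (fun t : ℝ => G ((t : ℂ) * z)) (F ((t : ℂ) * z) * z) t := by
    intro t ht
    have h1 : HasDerivAt (fun t : ℝ => (t : ℂ) * z) z t := by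
      simpa using (Complex.ofRealCLM.hasDerivAt (x := t)).mul_const z
    exact (hG _ (hmem t ht)).comp t h1
  unfold integralFromZero
  rw [intervalIntegral.integral_eq_sub_of_hasDerivAt hd]
  · simp [hG0]
  · apply ContinuousOn.intervalIntegrable
    refine ContinuousOn.mul (hF.comp ?_ hmem) continuousOn_const
    fun_prop

lemma root_norm (n k : ℕ) : ‖root n k‖ = 1 := by
  have : root n k = exp ((2 * Real.pi * k / n : ℝ) * I) := by
    unfold root
    congr 1
    push_cast
    ring
  rw [this, norm_exp_ofReal_mul_I]

/-- As wⁿ = 1, a finite geometric sum gives w/(w - z) = ∑ zʲw⁻ʲ/(1 - zⁿ) with j < n. Summing over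
the roots w kills every power j ≠ 0 and leaves n/(1 - zⁿ). -/
lemma sum_root_div_sub {n : ℕ} (hn : 1 ≤ n) {z : ℂ} (hz : z ∈ disk) :
    1 / (1 - z ^ n) = 1 / (n : ℂ) * ∑ k ∈ Finset.range n, root n k / (root n k - z) := by
  have hn0 : (n : ℂ) ≠ 0 := by exact_mod_cast (by omega : n ≠ 0)
  have h1 := one_sub_ne_zero (pow_mem_disk hz hn)
  have hprim := (Complex.isPrimitiveRoot_exp n (by omega)).inv
  set ξ : ℂ := (exp (2 * Real.pi * I / n))⁻¹ with hξ
  have hroot : ∀ k, (root n k)⁻¹ = ξ ^ k := by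
    intro k
    rw [hξ, inv_pow, ← Complex.exp_nat_mul]
    unfold root
    congr 2
    ring
  have hterm : ∀ k ∈ Finset.range n, root n k / (root n k - z) =
      (∑ j ∈ Finset.range n, z ^ j * (ξ ^ j) ^ k) / (1 - z ^ n) := by
    intro k _
    have hr0 : root n k ≠ 0 := by
      intro h
      have := root_norm n k
      simp [h] at this
    have h2 := sub_ne_zero_of_mem_disk (root_norm n k) hz
    have h3 := geom_sum_mul (z * (root n k)⁻¹) n
    have h4 : (root n k)⁻¹ ^ n = 1 := by
      rw [hroot, ← pow_mul, mul_comm, pow_mul, hprim.pow_eq_one, one_pow]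
    rw [mul_pow, h4, mul_one] at h3
    have h5 : ∑ j ∈ Finset.range n, z ^ j * (ξ ^ j) ^ k =
        ∑ j ∈ Finset.range n, (z * (root n k)⁻¹) ^ j := by
      refine Finset.sum_congr rfl fun j _ => ?_
      rw [mul_pow, hroot, ← pow_mul, ← pow_mul, mul_comm k j]
    rw [h5, div_eq_div_iff h2 h1]
    generalize ∑ j ∈ Finset.range n, (z * (root n k)⁻¹) ^ j = S at h3 ⊢
    field_simp at h3
    linear_combination h3
  rw [Finset.sum_congr rfl hterm, ← Finset.sum_div, Finset.sum_comm]
  have hsum : ∑ j ∈ Finset.range n, ∑ k ∈ Finset.range n, z ^ j * (ξ ^ j) ^ k = n := by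
    rw [Finset.sum_eq_single_of_mem 0 (Finset.mem_range.2 (by omega))]
    · simp
    · intro j hj hj0
      rw [← Finset.mul_sum]
      have h6 := mul_geom_sum (ξ ^ j) n
      rw [← pow_mul, mul_comm j n, pow_mul, hprim.pow_eq_one, one_pow, sub_self] at h6
      rcases mul_eq_zero.1 h6 with h7 | h7
      · exact absurd (sub_eq_zero.1 h7)
          (hprim.pow_ne_one_of_pos_of_lt hj0 (Finset.mem_range.1 hj))
      · rw [h7, mul_zero]
  rw [hsum]
  field_simp

lemma hasDerivAt_log_one_sub {z : ℂ} (hz : z ∈ disk) :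
    HasDerivAt (fun z => log (1 - z)) (-(1 / (1 - z))) z := by
  simpa using hasDerivAt_log_div_sub (w := 1) (by simp) hz

lemma hasDerivAt_log_one_add {z : ℂ} (hz : z ∈ disk) :
    HasDerivAt (fun z => log (1 + z)) (1 / (1 + z)) z := by
  have h := hasDerivAt_log_div_sub (w := -1) (by simp) hz
  have h0 := one_add_ne_zero hz
  convert! h using 1
  · funext z
    congr 1
    ring
  · have : -1 - z ≠ 0 := fun h => h0 (by linear_combination -h)
    field_simp
    ring

lemma hasDerivAt_I₁Term {w z : ℂ} (hw : ‖w‖ = 1) (hz : z ∈ disk) :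
    HasDerivAt (I₁Term w) (1 / (1 - z ^ 2) * (w / (w - z))) z := by
  have h1 := one_sub_ne_zero hz
  have h2 := one_add_ne_zero hz
  have h3 := one_sub_sq_ne_zero hz
  have h4 := sub_ne_zero_of_mem_disk hw hz
  have h5 : 1 - z ^ 2 = (1 - z) * (1 + z) := by ring
  have hid := hasDerivAt_id z
  by_cases hw1 : w = 1
  · subst hw1
    have e : I₁Term 1 = fun z => 1 / 2 * (z / (1 - z)) + 1 / 4 * log ((1 + z) / (1 - z)) := by
      funext z
      simp [I₁Term]
    rw [e]
    have := (((hid.div (hid.const_sub 1) h1).const_mul (1 / 2)).add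
      ((hasDerivAt_log_cayley hz).const_mul (1 / 4)))
    convert! this using 1
    simp only [id]
    rw [h5]
    field_simp
    ring
  by_cases hw2 : w = -1
  · subst hw2
    have e : I₁Term (-1) = fun z => 1 / 2 * (z / (1 + z)) + 1 / 4 * log ((1 + z) / (1 - z)) := by
      funext z
      simp [I₁Term, hw1]
    rw [e]
    have := (((hid.div (hid.const_add 1) h2).const_mul (1 / 2)).add
      ((hasDerivAt_log_cayley hz).const_mul (1 / 4)))
    convert! this using 1
    simp only [id]
    rw [h5]
    field_simp
    ring
  · have e : I₁Term w = fun z => -(w * log (1 - z) / (2 * (w - 1)))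
        + w * log (1 + z) / (2 * (w + 1)) + w / (w ^ 2 - 1) * log ((w - z) / w) := by
      funext z
      simp [I₁Term, hw1, hw2]
    rw [e]
    have := ((((((hasDerivAt_log_one_sub hz).const_mul w).div_const (2 * (w - 1))).neg).add
      (((hasDerivAt_log_one_add hz).const_mul w).div_const (2 * (w + 1)))).add
      ((hasDerivAt_log_div_sub hw hz).const_mul (w / (w ^ 2 - 1))))
    convert! this using 1
    have h6 : w - 1 ≠ 0 := sub_ne_zero.2 hw1
    have h7 : w + 1 ≠ 0 := fun h => hw2 (by linear_combination h)
    have h8 : w ^ 2 - 1 = (w - 1) * (w + 1) := by ring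
    rw [h5, h8]
    field_simp
    ring

lemma hasDerivAt_JTerm {η w z : ℂ} (hη : ‖η‖ = 1) (hw : ‖w‖ = 1) (hz : z ∈ disk) :
    HasDerivAt (JTerm η w) (-(1 / (z - η) ^ 2 * (w / (w - z)))) z := by
  have h1 := sub_ne_zero_of_mem_disk hη hz
  have h2 := sub_ne_zero_of_mem_disk hw hz
  have h3 : z - η ≠ 0 := fun h => h1 (by linear_combination -h)
  have hid := hasDerivAt_id z
  by_cases h : w = η
  · subst h
    have e : JTerm w w = fun z => -(w / 2 * (1 / (z - w) ^ 2 - 1 / w ^ 2)) := by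
      funext z
      simp [JTerm]
    rw [e]
    have := (((((hid.sub_const w).pow 2).inv (pow_ne_zero 2 h3)).sub_const
      (1 / w ^ 2)).const_mul (w / 2)).neg
    convert! this using 1
    · funext z
      simp
    · simp only [id, Pi.pow_apply]
      have : w - z = -(z - w) := by ring
      rw [this]
      field_simp
      norm_num
      ring
  · have e : JTerm η w = fun z => w * (1 / (η - w) * (1 / (η - z) - 1 / η)
        - 1 / (η - w) ^ 2 * (log ((η - z) / η) - log ((w - z) / w))) := by
      funext z
      simp [JTerm, h]
    rw [e]
    have := (((((hid.const_sub η).inv h1).sub_const (1 / η)).const_mul (1 / (η - w))).sub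
      (((hasDerivAt_log_div_sub hη hz).sub (hasDerivAt_log_div_sub hw hz)).const_mul
        (1 / (η - w) ^ 2))).const_mul w
    convert! this using 1
    · funext z
      simp
    · have h5 : η - w ≠ 0 := fun h' => h (by linear_combination -h')
      have : z - η = -(η - z) := by ring
      rw [this]
      simp only [id]
      field_simp
      ring

lemma I₁Term_zero {w : ℂ} (hw : ‖w‖ = 1) : I₁Term w 0 = 0 := by
  have hw0 : w ≠ 0 := by rintro rfl; simp at hw
  simp [I₁Term, hw0]

lemma JTerm_zero {η w : ℂ} (hη : ‖η‖ = 1) (hw : ‖w‖ = 1) : JTerm η w 0 = 0 := by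
  have hw0 : w ≠ 0 := by rintro rfl; simp at hw
  have hη0 : η ≠ 0 := by rintro rfl; simp at hη
  simp [JTerm, hw0, hη0]

lemma hasDerivAt_I₁Closed {n : ℕ} (hn : 1 ≤ n) {z : ℂ} (hz : z ∈ disk) :
    HasDerivAt (I₁Closed n) (1 / ((1 - z ^ 2) * (1 - z ^ n))) z := by
  have := (HasDerivAt.fun_sum fun k (_ : k ∈ Finset.range n) =>
    hasDerivAt_I₁Term (root_norm n k) hz).const_mul (1 / (n : ℂ))
  convert! this using 1
  rw [← Finset.mul_sum, mul_left_comm, ← sum_root_div_sub hn hz, one_div_mul_one_div]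

lemma hasDerivAt_JClosed {n : ℕ} (hn : 1 ≤ n) {η z : ℂ} (hη : ‖η‖ = 1) (hz : z ∈ disk) :
    HasDerivAt (JClosed n η) (1 / ((z - η) ^ 2 * (1 - z ^ n))) z := by
  have := (HasDerivAt.fun_sum fun k (_ : k ∈ Finset.range n) =>
    hasDerivAt_JTerm hη (root_norm n k) hz).const_mul (-(1 / (n : ℂ)))
  convert! this using 1
  rw [Finset.sum_neg_distrib, neg_mul_neg, ← Finset.mul_sum, mul_left_comm,
    ← sum_root_div_sub hn hz, one_div_mul_one_div]

lemma I₁_eq_closed {n : ℕ} (hn : 1 ≤ n) {z : ℂ} (hz : z ∈ disk) : I₁ n z = I₁Closed n z := by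
  refine integralFromZero_eq ?_ (fun z hz => hasDerivAt_I₁Closed hn hz) ?_ hz
  · refine ContinuousOn.div continuousOn_const (by fun_prop) fun z hz => ?_
    exact mul_ne_zero (one_sub_sq_ne_zero hz) (one_sub_ne_zero (pow_mem_disk hz hn))
  · simp [I₁Closed, I₁Term_zero (root_norm n _)]

lemma J_eq_closed {n : ℕ} (hn : 1 ≤ n) {η z : ℂ} (hη : ‖η‖ = 1) (hz : z ∈ disk) :
    J n η z = JClosed n η z := by
  refine integralFromZero_eq ?_ (fun z hz => hasDerivAt_JClosed hn hη hz) ?_ hz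
  · refine ContinuousOn.div continuousOn_const (by fun_prop) fun z hz => ?_
    refine mul_ne_zero (pow_ne_zero 2 fun h => ?_) (one_sub_ne_zero (pow_mem_disk hz hn))
    exact sub_ne_zero_of_mem_disk hη hz (by linear_combination -h)
  · simp [JClosed, JTerm_zero hη (root_norm n _)]

/-! ### Univalence of φ_α -/

/-- The Noshiro–Warschawski criterion. -/
lemma injOn_of_re_deriv_pos {S : Set ℂ} (hS : Convex ℝ S) {f f' : ℂ → ℂ}
    (hf : ∀ z ∈ S, HasDerivAt f (f' z) z) (hpos : ∀ z ∈ S, 0 < (f' z).re) : Set.InjOn f S := by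
  intro a ha b hb hab
  by_contra hne
  have hd : b - a ≠ 0 := sub_ne_zero.2 (Ne.symm hne)
  have hmem : ∀ t ∈ Set.Icc (0 : ℝ) 1, a + t * (b - a) ∈ S := by
    intro t ht
    have := hS.add_smul_sub_mem ha hb ht
    simpa using this
  -- Projecting f along the chord onto its direction b - a gives a real function with derivative Re
  -- f' · |b - a|².
  have hder : ∀ t ∈ Set.Icc (0 : ℝ) 1,
      HasDerivAt (fun t : ℝ => (f (a + t * (b - a)) * (starRingEnd ℂ) (b - a)).re)
        ((f' (a + t * (b - a))).re * normSq (b - a)) t := by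
    intro t ht
    have h1 : HasDerivAt (fun t : ℝ => a + (t : ℂ) * (b - a)) (b - a) t := by
      simpa using ((Complex.ofRealCLM.hasDerivAt (x := t)).mul_const (b - a)).const_add a
    have h2 := ((hf _ (hmem t ht)).comp t h1).mul_const ((starRingEnd ℂ) (b - a))
    have h3 := (Complex.reCLM.hasFDerivAt.comp_hasDerivAt t h2)
    convert! h3 using 1
    rw [mul_assoc, mul_conj]
    simp
  have hmono : StrictMonoOn (fun t : ℝ => (f (a + t * (b - a)) * (starRingEnd ℂ) (b - a)).re)
      (Set.Icc 0 1) := by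
    refine strictMonoOn_of_deriv_pos (convex_Icc 0 1)
      (fun t ht => (hder t ht).continuousAt.continuousWithinAt) fun t ht => ?_
    rw [interior_Icc] at ht
    rw [(hder t (Set.Ioo_subset_Icc_self ht)).deriv]
    exact mul_pos (hpos _ (hmem t (Set.Ioo_subset_Icc_self ht))) (normSq_pos.2 hd)
  have := hmono (Set.left_mem_Icc.2 zero_le_one) (Set.right_mem_Icc.2 zero_le_one) zero_lt_one
  simp [hab] at this

/-- The derivative of `φ_α`. -/
def phiDeriv (α : ℝ) (z : ℂ) : ℂ :=
  (Real.sin α : ℂ) ^ 2 / (1 - z ^ 2)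
    + (Real.cos α : ℂ) ^ 2 * (1 - z ^ 2) / (1 + z ^ 2) ^ 2

lemma hasDerivAt_phi (α : ℝ) {z : ℂ} (hz : z ∈ disk) :
    HasDerivAt (phi α) (phiDeriv α z) z := by
  have h1 := one_sub_sq_ne_zero hz
  have h2 := one_add_sq_ne_zero hz
  have hid := hasDerivAt_id z
  have := ((hasDerivAt_log_cayley hz).const_mul (1 / 2 * (Real.sin α : ℂ) ^ 2)).add
    ((hid.mul_const ((Real.cos α : ℂ) ^ 2)).div ((hid.pow 2).const_add 1) h2)
  convert! this using 1
  unfold phiDeriv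
  simp only [id, Pi.pow_apply]
  field_simp
  push_cast
  ring

/-- The product is a nonnegative combination of the Cayley transform at z² and at -z², with sin²α >
0. -/
lemma re_mul_phiDeriv_pos {α : ℝ} (hs : 0 < Real.sin α) {z : ℂ} (hz : z ∈ disk) :
    0 < ((1 + z ^ 2) * phiDeriv α z).re := by
  have h1 := one_sub_sq_ne_zero hz
  have h2 := one_add_sq_ne_zero hz
  have hu := pow_mem_disk hz (n := 2) (by norm_num)
  have hu' : -z ^ 2 ∈ disk := by
    rw [mem_disk, norm_neg]
    exact mem_disk.1 hu
  have h3 := re_cayley_pos hu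
  have h4 := re_cayley_pos hu'
  have h5 : (1 + z ^ 2) * phiDeriv α z =
      ((Real.sin α ^ 2 : ℝ) : ℂ) * ((1 + z ^ 2) / (1 - z ^ 2))
        + ((Real.cos α ^ 2 : ℝ) : ℂ) * ((1 + -z ^ 2) / (1 - -z ^ 2)) := by
    unfold phiDeriv
    push_cast
    rw [sub_neg_eq_add, ← sub_eq_add_neg]
    field_simp
  rw [h5, add_re, re_ofReal_mul, re_ofReal_mul]
  have := sq_nonneg (Real.cos α)
  positivity

lemma phiDeriv_ne_zero {α : ℝ} (hs : 0 < Real.sin α) {z : ℂ} (hz : z ∈ disk) :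
    phiDeriv α z ≠ 0 := by
  intro h
  have := re_mul_phiDeriv_pos hs hz
  simp [h] at this

lemma differentiableOn_phi (α : ℝ) : DifferentiableOn ℂ (phi α) disk :=
  fun _ hz => (hasDerivAt_phi α hz).differentiableAt.differentiableWithinAt

/-- The conformal map of the strip `|Im l| < π / 2` onto the unit disk whose ends at `±∞` go
to `∓i`. -/
def stripMap (l : ℂ) : ℂ := -I * ((exp l - 1) / (exp l + 1))

lemma re_exp_pos {l : ℂ} (hl : l.im ∈ Set.Ioo (-(Real.pi / 2)) (Real.pi / 2)) :
    0 < (exp l).re := by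
  rw [exp_re]
  exact mul_pos (Real.exp_pos _) (Real.cos_pos_of_mem_Ioo hl)

lemma stripMap_mem_disk {l : ℂ} (hl : l.im ∈ Set.Ioo (-(Real.pi / 2)) (Real.pi / 2)) :
    stripMap l ∈ disk := by
  have h := re_exp_pos hl
  have h1 : exp l + 1 ≠ 0 := by
    intro h'
    have := congrArg re h'
    simp only [add_re, one_re, zero_re] at this
    linarith
  rw [mem_disk, stripMap, norm_mul, norm_neg, norm_I, one_mul, norm_div,
    div_lt_one (norm_pos_iff.2 h1)]
  rw [← sq_lt_sq₀ (norm_nonneg _) (norm_nonneg _), ← normSq_eq_norm_sq, ← normSq_eq_norm_sq,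
    normSq_apply, normSq_apply]
  simp only [sub_re, sub_im, add_re, add_im, one_re, one_im]
  nlinarith

lemma exists_stripMap_eq {z : ℂ} (hz : z ∈ disk) :
    ∃ l : ℂ, l.im ∈ Set.Ioo (-(Real.pi / 2)) (Real.pi / 2) ∧ stripMap l = z := by
  have hz' : I * z ∈ disk := by
    rw [mem_disk, norm_mul, norm_I, one_mul]
    exact mem_disk.1 hz
  have h1 := re_cayley_pos hz'
  have h2 := one_sub_ne_zero hz'
  -- The inverse of the strip map: (1 + iz)/(1 - iz) lies in the right half-plane, so its logarithm
  -- lies in the strip.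
  refine ⟨log ((1 + I * z) / (1 - I * z)), ?_, ?_⟩
  · rw [log_im, Set.mem_Ioo, ← abs_lt]
    exact abs_arg_lt_pi_div_two_iff.2 (Or.inl h1)
  · unfold stripMap
    rw [exp_log (fun h => by simp [h] at h1)]
    have h3 : (1 + I * z) / (1 - I * z) + 1 = 2 / (1 - I * z) := by
      field_simp
      ring
    have h4 : (1 + I * z) / (1 - I * z) - 1 = 2 * (I * z) / (1 - I * z) := by
      field_simp
      ring
    rw [h3, h4]
    field_simp
    linear_combination -z * I_sq

lemma hasDerivAt_stripMap {l : ℂ} (hl : l.im ∈ Set.Ioo (-(Real.pi / 2)) (Real.pi / 2)) :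
    HasDerivAt stripMap (-(I / 2) * (1 + stripMap l ^ 2)) l := by
  have h := re_exp_pos hl
  have h1 : exp l + 1 ≠ 0 := by
    intro h'
    have := congrArg re h'
    simp only [add_re, one_re, zero_re] at this
    linarith
  have := ((((hasDerivAt_exp l).sub_const 1).div ((hasDerivAt_exp l).add_const 1) h1).const_mul
    (-I))
  convert! this using 1
  unfold stripMap
  rw [mul_pow, neg_sq, I_sq]
  field_simp
  ring

/-- Passing to the strip replaces the non-constant factor 1 + z² by a change of variable, after
which the derivative itself has positive real part on a convex set. -/
lemma injOn_phi {α : ℝ} (hs : 0 < Real.sin α) : Set.InjOn (phi α) disk := by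
  set S : Set ℂ := {l : ℂ | l.im ∈ Set.Ioo (-(Real.pi / 2)) (Real.pi / 2)} with hSdef
  have hS : Convex ℝ S := (convex_Ioo _ _).linear_preimage imLm
  have hinj : Set.InjOn (fun l => 2 * I * phi α (stripMap l)) S := by
    refine injOn_of_re_deriv_pos hS
      (f' := fun l => (1 + stripMap l ^ 2) * phiDeriv α (stripMap l)) (fun l hl => ?_)
      (fun l hl => re_mul_phiDeriv_pos hs (stripMap_mem_disk hl))
    have := ((hasDerivAt_phi α (stripMap_mem_disk hl)).comp l (hasDerivAt_stripMap hl)).const_mul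
      (2 * I)
    convert! this using 1
    linear_combination ((1 + stripMap l ^ 2) * phiDeriv α (stripMap l)) * I_sq
  intro a ha b hb hab
  obtain ⟨l, hl, rfl⟩ := exists_stripMap_eq ha
  obtain ⟨m, hm, rfl⟩ := exists_stripMap_eq hb
  rw [hinj hl hm (by simp only [hab])]

/-! ### Boundary values of φ_α on the unit circle -/

/-- The abscissa of the boundary value of `φ_α` at the point of the unit circle with abscissa `u`
in the open first quadrant. -/
def boundaryAbscissa (α u : ℝ) : ℝ :=
  Real.sin α ^ 2 / 4 * Real.log ((1 + u) / (1 - u)) + Real.cos α ^ 2 / (2 * u)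

lemma hasDerivAt_boundaryAbscissa (α : ℝ) {u : ℝ} (hu : u ∈ Set.Ioo (0 : ℝ) 1) :
    HasDerivAt (boundaryAbscissa α)
      ((u ^ 2 - Real.cos α ^ 2) / (2 * u ^ 2 * (1 - u ^ 2))) u := by
  have h0 : u ≠ 0 := hu.1.ne'
  have h1 : 1 - u ≠ 0 := (sub_pos.2 hu.2).ne'
  have h2 : 1 + u ≠ 0 := by linarith [hu.1]
  have h3 : (1 + u) / (1 - u) ≠ 0 := div_ne_zero h2 h1
  have hid := hasDerivAt_id u
  have := ((((hid.const_add 1).div (hid.const_sub 1) h1).log h3).const_mul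
    (Real.sin α ^ 2 / 4)).add
    ((hasDerivAt_const u (Real.cos α ^ 2)).div (hid.const_mul 2) (mul_ne_zero two_ne_zero h0))
  convert! this using 1
  simp only [id, Pi.div_apply]
  have h5 : 1 - u ^ 2 = (1 - u) * (1 + u) := by ring
  rw [h5, Real.sin_sq]
  field_simp
  ring

/-- The half-angle identity (1 + cos α)/(1 - cos α) = cot²(α/2) identifies the tip with the value at
u = cos α, the critical point of the abscissa. -/
lemma slitTip_eq {α : ℝ} (hα₀ : 0 < α) (hα₁ : α < Real.pi / 2) :
    slitTip α = boundaryAbscissa α (Real.cos α) := by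
  have hc : 0 < Real.cos α := Real.cos_pos_of_mem_Ioo ⟨by linarith, hα₁⟩
  have hc2 : 0 < Real.cos (α / 2) := Real.cos_pos_of_mem_Ioo ⟨by linarith, by linarith⟩
  have hs2 : 0 < Real.sin (α / 2) := Real.sin_pos_of_pos_of_lt_pi (by linarith) (by linarith)
  have h1 : (1 + Real.cos α) / (1 - Real.cos α) = Real.cot (α / 2) ^ 2 := by
    have e1 : Real.cos α = 2 * Real.cos (α / 2) ^ 2 - 1 := by
      rw [← Real.cos_two_mul]
      ring_nf
    have e2 : 1 - Real.cos α = 2 * Real.sin (α / 2) ^ 2 := by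
      rw [e1, Real.sin_sq]
      ring
    rw [e2, Real.cot_eq_cos_div_sin, e1]
    field_simp
    ring
  unfold slitTip boundaryAbscissa
  rw [h1, Real.log_pow]
  field_simp
  push_cast
  ring

lemma slitTip_le_boundaryAbscissa {α : ℝ} (hα₀ : 0 < α) (hα₁ : α < Real.pi / 2) {u : ℝ}
    (hu : u ∈ Set.Ioo (0 : ℝ) 1) : slitTip α ≤ boundaryAbscissa α u := by
  have hc : 0 < Real.cos α := Real.cos_pos_of_mem_Ioo ⟨by linarith, hα₁⟩
  have hs : 0 < Real.sin α := Real.sin_pos_of_pos_of_lt_pi hα₀ (by linarith)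
  have hc1 : Real.cos α < 1 := by nlinarith [Real.sin_sq_add_cos_sq α]
  rw [slitTip_eq hα₀ hα₁]
  rcases le_total u (Real.cos α) with h | h
  · have hsub : ∀ x ∈ Set.Icc u (Real.cos α), x ∈ Set.Ioo (0 : ℝ) 1 := fun x hx =>
      ⟨hu.1.trans_le hx.1, hx.2.trans_lt hc1⟩
    refine antitoneOn_of_deriv_nonpos (convex_Icc u (Real.cos α))
      (fun x hx => (hasDerivAt_boundaryAbscissa α (hsub x hx)).continuousAt.continuousWithinAt)
      (fun x hx => (hasDerivAt_boundaryAbscissa α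
        (hsub x (interior_subset hx))).differentiableAt.differentiableWithinAt)
      (fun x hx => ?_) (Set.left_mem_Icc.2 h) (Set.right_mem_Icc.2 h) h
    have hx' := hsub x (interior_subset hx)
    have hx'' := interior_subset hx
    rw [(hasDerivAt_boundaryAbscissa α hx').deriv]
    apply div_nonpos_of_nonpos_of_nonneg
    · nlinarith [hx'.1, hx''.2]
    · have : 0 < 1 - x ^ 2 := by nlinarith [hx'.1, hx'.2]
      positivity
  · have hsub : ∀ x ∈ Set.Icc (Real.cos α) u, x ∈ Set.Ioo (0 : ℝ) 1 := fun x hx =>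
      ⟨hc.trans_le hx.1, hx.2.trans_lt hu.2⟩
    refine monotoneOn_of_deriv_nonneg (convex_Icc (Real.cos α) u)
      (fun x hx => (hasDerivAt_boundaryAbscissa α (hsub x hx)).continuousAt.continuousWithinAt)
      (fun x hx => (hasDerivAt_boundaryAbscissa α
        (hsub x (interior_subset hx))).differentiableAt.differentiableWithinAt)
      (fun x hx => ?_) (Set.left_mem_Icc.2 h) (Set.right_mem_Icc.2 h) h
    have hx' := hsub x (interior_subset hx)
    have hx'' := interior_subset hx
    rw [(hasDerivAt_boundaryAbscissa α hx').deriv]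
    apply div_nonneg
    · nlinarith [hx'.1, hx''.1]
    · have : 0 < 1 - x ^ 2 := by nlinarith [hx'.1, hx'.2]
      positivity

lemma exists_boundaryAbscissa_eq {α : ℝ} (hα₀ : 0 < α) (hα₁ : α < Real.pi / 2) {x : ℝ}
    (hx : slitTip α ≤ x) : ∃ u ∈ Set.Ioo (0 : ℝ) 1, boundaryAbscissa α u = x := by
  have hc : 0 < Real.cos α := Real.cos_pos_of_mem_Ioo ⟨by linarith, hα₁⟩
  have hs : 0 < Real.sin α := Real.sin_pos_of_pos_of_lt_pi hα₀ (by linarith)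
  have hc1 : Real.cos α < 1 := by nlinarith [Real.sin_sq_add_cos_sq α]
  -- K is large enough for the logarithmic term alone to reach x; u = tanh(K/2) is chosen so that
  -- log((1 + u)/(1 - u)) = K. The intermediate value theorem between cos α and u then applies.
  set K : ℝ := |4 * x / Real.sin α ^ 2| + 1 with hK
  have hK0 : 0 < K := by positivity
  have hE : 1 < Real.exp K := Real.one_lt_exp_iff.2 hK0
  set u : ℝ := (Real.exp K - 1) / (Real.exp K + 1) with hu
  have hu0 : 0 < u := div_pos (by linarith) (by linarith)
  have hu1 : u < 1 := by
    rw [hu, div_lt_one (by linarith)]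
    linarith
  have hue : (1 + u) / (1 - u) = Real.exp K := by
    have h3 : 1 - u = 2 / (Real.exp K + 1) := by
      rw [hu]
      field_simp
      ring
    have h4 : 1 + u = 2 * Real.exp K / (Real.exp K + 1) := by
      rw [hu]
      field_simp
      ring
    rw [h3, h4]
    field_simp
  have hxu : x ≤ boundaryAbscissa α u := by
    unfold boundaryAbscissa
    rw [hue, Real.log_exp]
    have h1 : 4 * x / Real.sin α ^ 2 ≤ K := by
      rw [hK]
      linarith [le_abs_self (4 * x / Real.sin α ^ 2)]
    rw [div_le_iff₀ (by positivity)] at h1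
    have h2 : 0 < Real.cos α ^ 2 / (2 * u) := by positivity
    nlinarith
  have hsub : Set.uIcc (Real.cos α) u ⊆ Set.Ioo (0 : ℝ) 1 :=
    Set.ordConnected_Ioo.uIcc_subset ⟨hc, hc1⟩ ⟨hu0, hu1⟩
  have hcont : ContinuousOn (boundaryAbscissa α) (Set.uIcc (Real.cos α) u) := fun y hy =>
    (hasDerivAt_boundaryAbscissa α (hsub hy)).continuousAt.continuousWithinAt
  rw [slitTip_eq hα₀ hα₁] at hx
  obtain ⟨y, hy, hyx⟩ := intermediate_value_uIcc hcont
    (Set.Icc_subset_uIcc (⟨hx, hxu⟩ : x ∈ Set.Icc _ _))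
  exact ⟨y, hsub hy, hyx⟩

lemma slitTip_pos {α : ℝ} (hα₀ : 0 < α) (hα₁ : α < Real.pi / 2) : 0 < slitTip α := by
  have hc : 0 < Real.cos α := Real.cos_pos_of_mem_Ioo ⟨by linarith, hα₁⟩
  have hs : 0 < Real.sin α := Real.sin_pos_of_pos_of_lt_pi hα₀ (by linarith)
  have hc1 : Real.cos α < 1 := by nlinarith [Real.sin_sq_add_cos_sq α]
  rw [slitTip_eq hα₀ hα₁]
  have : 0 ≤ Real.log ((1 + Real.cos α) / (1 - Real.cos α)) := by
    apply Real.log_nonneg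
    rw [le_div_iff₀ (by linarith)]
    linarith
  unfold boundaryAbscissa
  positivity

lemma slitHeight_pos {α : ℝ} (hα₀ : 0 < α) (hα₁ : α < Real.pi / 2) : 0 < slitHeight α := by
  have hs : 0 < Real.sin α := Real.sin_pos_of_pos_of_lt_pi hα₀ (by linarith)
  unfold slitHeight
  have := Real.pi_pos
  positivity

lemma mem_fourSlitDomain {α : ℝ} (hα₀ : 0 < α) (hα₁ : α < Real.pi / 2) {w : ℂ} :
    w ∈ fourSlitDomain α ↔ ¬ (|w.im| = slitHeight α ∧ slitTip α ≤ |w.re|) := by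
  have hH := slitHeight_pos hα₀ hα₁
  rw [abs_eq hH.le, le_abs]
  simp only [fourSlitDomain, leftHalfLine, rightHalfLine, Set.mem_compl_iff, Set.mem_union,
    Set.mem_ofPred_eq, le_neg (a := slitTip α)]
  tauto

/-- On the circle the Cayley transform is the purely imaginary number iv/(1 - u), so the logarithm
has constant imaginary part π/2, while 1 + z² = 2uz makes the rational term real. -/
lemma phi_circle {α u v : ℝ} (hu : u ∈ Set.Ioo (0 : ℝ) 1) (hv : 0 < v)
    (huv : u ^ 2 + v ^ 2 = 1) :
    phi α (u + v * I) = boundaryAbscissa α u + slitHeight α * I := by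
  have h1 : 0 < 1 - u := sub_pos.2 hu.2
  have hr : 0 < v / (1 - u) := div_pos hv h1
  have huC : (u : ℂ) ≠ 0 := by exact_mod_cast hu.1.ne'
  have huvC : (u : ℂ) ^ 2 + (v : ℂ) ^ 2 = 1 := by exact_mod_cast huv
  have h1C : (1 : ℂ) - u ≠ 0 := by exact_mod_cast h1.ne'
  have hz1 : (1 : ℂ) - (u + v * I) ≠ 0 := by
    intro h
    have := congrArg im h
    simp at this
    exact hv.ne' this
  have h2 : (1 + (u + v * I : ℂ)) / (1 - (u + v * I)) = ((v / (1 - u) : ℝ) : ℂ) * I := by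
    rw [div_eq_iff hz1]
    push_cast
    field_simp
    linear_combination (v : ℂ) ^ 2 * I_sq - huvC
  have h3 : log ((1 + (u + v * I : ℂ)) / (1 - (u + v * I))) =
      ((1 / 2 * Real.log ((1 + u) / (1 - u)) : ℝ) : ℂ) + Real.pi / 2 * I := by
    rw [h2, log_ofReal_mul hr I_ne_zero, log_I]
    congr 2
    have : (1 + u) / (1 - u) = (v / (1 - u)) ^ 2 := by
      field_simp
      linear_combination -huv
    rw [this, Real.log_pow]
    push_cast
    ring
  have h4 : (1 : ℂ) + (u + v * I) ^ 2 = 2 * u * (u + v * I) := by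
    linear_combination (v : ℂ) ^ 2 * I_sq - huvC
  have hz : (u : ℂ) + v * I ≠ 0 := by
    intro h
    have := congrArg im h
    simp at this
    exact hv.ne' this
  unfold phi
  rw [h3, h4, mul_comm (2 * (u : ℂ)), mul_div_mul_left _ _ hz]
  unfold boundaryAbscissa slitHeight
  push_cast
  field_simp
  ring

lemma re_cayley_nonneg {z : ℂ} (hz : ‖z‖ ≤ 1) : 0 ≤ ((1 + z) / (1 - z)).re := by
  -- This also holds at z = 1, where both sides are 0 by the convention for division by zero.
  have h3 : ((1 + z) / (1 - z)).re = (1 - normSq z) / normSq (1 - z) := by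
    rw [Complex.div_re, ← add_div]
    congr 1
    simp [normSq_apply]
    ring
  rw [h3]
  apply div_nonneg _ (normSq_nonneg _)
  rw [normSq_eq_norm_sq]
  nlinarith [norm_nonneg z]

lemma arg_cayley_ne_pi {z : ℂ} (hz : ‖z‖ ≤ 1) : ((1 + z) / (1 - z)).arg ≠ Real.pi := by
  intro h
  rw [arg_eq_pi_iff] at h
  linarith [re_cayley_nonneg hz, h.1]

lemma phi_neg (α : ℝ) {z : ℂ} (hz : ‖z‖ ≤ 1) : phi α (-z) = -phi α z := by
  have h : (1 + -z) / (1 - -z) = ((1 + z) / (1 - z))⁻¹ := by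
    rw [inv_div, sub_neg_eq_add, ← sub_eq_add_neg]
  unfold phi
  rw [h, log_inv _ (arg_cayley_ne_pi hz)]
  ring

lemma phi_conj (α : ℝ) {z : ℂ} (hz : ‖z‖ ≤ 1) :
    phi α ((starRingEnd ℂ) z) = (starRingEnd ℂ) (phi α z) := by
  have h : (1 + (starRingEnd ℂ) z) / (1 - (starRingEnd ℂ) z) =
      (starRingEnd ℂ) ((1 + z) / (1 - z)) := by simp
  unfold phi
  rw [h, log_conj _ (arg_cayley_ne_pi hz)]
  simp only [map_add, map_mul, map_div₀, map_pow, map_one, conj_ofReal, map_ofNat]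

lemma abs_phi_circle {α : ℝ} (hα₀ : 0 < α) (hα₁ : α < Real.pi / 2) {z : ℂ} (hz : ‖z‖ = 1)
    (hre : z.re ≠ 0) (him : z.im ≠ 0) :
    |(phi α z).re| = boundaryAbscissa α |z.re| ∧ |(phi α z).im| = slitHeight α := by
  have key : ∀ w : ℂ, ‖w‖ = 1 → 0 < w.re → 0 < w.im →
      |(phi α w).re| = boundaryAbscissa α |w.re| ∧ |(phi α w).im| = slitHeight α := by
    intro w hw h1 h2
    have h3 : w.re ^ 2 + w.im ^ 2 = 1 := by
      have := Complex.sq_norm w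
      rw [hw, normSq_apply] at this
      linarith
    have h4 : w.re ∈ Set.Ioo (0 : ℝ) 1 := ⟨h1, by nlinarith⟩
    have h5 := phi_circle (α := α) h4 h2 h3
    rw [re_add_im] at h5
    have h6 := (slitTip_pos hα₀ hα₁).trans_le (slitTip_le_boundaryAbscissa hα₀ hα₁ h4)
    rw [h5, abs_of_pos h1]
    simp [abs_of_pos h6, abs_of_pos (slitHeight_pos hα₀ hα₁)]
  have key2 : ∀ w : ℂ, ‖w‖ = 1 → 0 < w.re → w.im ≠ 0 →
      |(phi α w).re| = boundaryAbscissa α |w.re| ∧ |(phi α w).im| = slitHeight α := by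
    intro w hw h1 h2
    rcases h2.lt_or_gt with h | h
    · have := key ((starRingEnd ℂ) w) (by simpa using hw) (by simpa using h1) (by simpa using h)
      rw [phi_conj α hw.le] at this
      simpa using this
    · exact key w hw h1 h
  rcases hre.lt_or_gt with h | h
  · have := key2 (-z) (by simpa using hz) (by simpa using h) (by simpa using him)
    rw [phi_neg α hz.le] at this
    simpa using this
  · exact key2 z hz h him

lemma phi_circle_notMem {α : ℝ} (hα₀ : 0 < α) (hα₁ : α < Real.pi / 2) {z : ℂ} (hz : ‖z‖ = 1)
    (hre : z.re ≠ 0) (him : z.im ≠ 0) : phi α z ∉ fourSlitDomain α := by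
  obtain ⟨h1, h2⟩ := abs_phi_circle hα₀ hα₁ hz hre him
  rw [mem_fourSlitDomain hα₀ hα₁, not_not]
  refine ⟨h2, h1 ▸ slitTip_le_boundaryAbscissa hα₀ hα₁ ⟨abs_pos.2 hre, ?_⟩⟩
  have h3 := Complex.sq_norm z
  rw [hz, normSq_apply] at h3
  have h4 : 0 < z.im * z.im := mul_self_pos.2 him
  rw [← sq_lt_one_iff_abs_lt_one]
  nlinarith

lemma exists_circle_phi_eq {α : ℝ} (hα₀ : 0 < α) (hα₁ : α < Real.pi / 2) {w : ℂ}
    (hw : w ∉ fourSlitDomain α) : ∃ z : ℂ, ‖z‖ = 1 ∧ z.re ≠ 0 ∧ z.im ≠ 0 ∧ phi α z = w := by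
  rw [mem_fourSlitDomain hα₀ hα₁, not_not] at hw
  obtain ⟨him, hre⟩ := hw
  obtain ⟨u, hu, hux⟩ := exists_boundaryAbscissa_eq hα₀ hα₁ hre
  have h1 : 0 < 1 - u ^ 2 := by nlinarith [hu.1, hu.2]
  set v := Real.sqrt (1 - u ^ 2) with hv
  have hv0 : 0 < v := Real.sqrt_pos.2 h1
  have huv : u ^ 2 + v ^ 2 = 1 := by
    rw [hv, Real.sq_sqrt h1.le]
    ring
  have hphi := phi_circle (α := α) hu hv0 huv
  rw [hux, ← him] at hphi
  set e : ℂ := u + v * I with he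
  have hen : ‖e‖ = 1 := by
    rw [← sq_eq_sq₀ (norm_nonneg _) zero_le_one, ← normSq_eq_norm_sq, he, normSq_add_mul_I, huv]
    norm_num
  have here : e.re ≠ 0 := by simpa [he] using hu.1.ne'
  have heim : e.im ≠ 0 := by simpa [he] using hv0.ne'
  have hec := phi_conj α hen.le
  have hecn := phi_neg α (z := (starRingEnd ℂ) e) (by simpa using hen.le)
  have hn := phi_neg α hen.le
  -- The signs of Re w and Im w decide which of e, its conjugate and their negatives is mapped to w.
  rcases abs_choice w.re with h | h <;> rcases abs_choice w.im with h' | h' <;>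
    rw [h, h'] at hphi
  · exact ⟨e, hen, here, heim, by rw [hphi, re_add_im]⟩
  · exact ⟨(starRingEnd ℂ) e, by simpa using hen, by simpa using here, by simpa using heim, by
      rw [hec, hphi]; apply Complex.ext <;> simp⟩
  · exact ⟨-(starRingEnd ℂ) e, by simpa using hen, by simpa using here, by simpa using heim, by
      rw [hecn, hec, hphi]; apply Complex.ext <;> simp⟩
  · exact ⟨-e, by simpa using hen, by simpa using here, by simpa using heim, by
      rw [hn, hphi]; apply Complex.ext <;> simp⟩

/-! ### The image of the disk under φ_α -/

lemma hasStrictDerivAt_phi (α : ℝ) {z : ℂ} (hz : z ∈ disk) :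
    HasStrictDerivAt (phi α) (phiDeriv α z) z := by
  have h := ((differentiableOn_phi α).analyticAt (isOpen_disk.mem_nhds hz)).hasStrictDerivAt
  rwa [(hasDerivAt_phi α hz).deriv] at h

lemma map_nhds_phi {α : ℝ} (hs : 0 < Real.sin α) {z : ℂ} (hz : z ∈ disk) :
    map (phi α) (𝓝 z) = 𝓝 (phi α z) :=
  (hasStrictDerivAt_phi α hz).map_nhds_eq (phiDeriv_ne_zero hs hz)

lemma isOpen_phi_image {α : ℝ} (hs : 0 < Real.sin α) {U : Set ℂ} (hU : IsOpen U)
    (hUd : U ⊆ disk) : IsOpen (phi α '' U) := by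
  rw [isOpen_iff_mem_nhds]
  rintro _ ⟨z, hz, rfl⟩
  rw [← map_nhds_phi hs (hUd hz)]
  exact image_mem_map (hU.mem_nhds hz)

lemma one_sub_ne_zero_of_im {z : ℂ} (him : z.im ≠ 0) : 1 - z ≠ 0 := by
  intro h
  have := congrArg im h
  simp at this
  exact him this

lemma cayley_mem_slitPlane {z : ℂ} (him : z.im ≠ 0) : (1 + z) / (1 - z) ∈ slitPlane := by
  right
  have h2 : 0 < normSq (1 - z) := normSq_pos.2 (one_sub_ne_zero_of_im him)
  have h3 : ((1 + z) / (1 - z)).im = 2 * z.im / normSq (1 - z) := by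
    rw [Complex.div_im, ← sub_div]
    congr 1
    simp
    ring
  rw [h3]
  positivity

lemma continuousAt_log_cayley {z : ℂ} (him : z.im ≠ 0) :
    ContinuousAt (fun z => log ((1 + z) / (1 - z))) z := by
  refine ContinuousAt.clog (ContinuousAt.div (by fun_prop) (by fun_prop) ?_)
    (cayley_mem_slitPlane him)
  exact one_sub_ne_zero_of_im him

lemma one_add_sq_ne_zero_of_re {z : ℂ} (hre : z.re ≠ 0) : 1 + z ^ 2 ≠ 0 := by
  intro h
  have h1 : (z - I) * (z + I) = 0 := by linear_combination h - I_sq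
  rcases mul_eq_zero.1 h1 with h2 | h2
  all_goals
    have := congrArg re h2
    simp at this
    exact hre this

lemma continuousAt_phi_of_ne (α : ℝ) {z : ℂ} (hre : z.re ≠ 0) (him : z.im ≠ 0) :
    ContinuousAt (phi α) z :=
  ((continuousAt_log_cayley him).const_mul _).add
    (ContinuousAt.div (by fun_prop) (by fun_prop) (one_add_sq_ne_zero_of_re hre))

/-- A value on a slit would also be the boundary value at some e on the circle. Disk points x near e
would then take values in the open image of a smaller disk around 0, and univalence would force x
into that smaller disk. -/
lemma phi_mem_fourSlitDomain {α : ℝ} (hα₀ : 0 < α) (hα₁ : α < Real.pi / 2) {z : ℂ}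
    (hz : z ∈ disk) : phi α z ∈ fourSlitDomain α := by
  have hs : 0 < Real.sin α := Real.sin_pos_of_pos_of_lt_pi hα₀ (by linarith [Real.pi_pos])
  by_contra hw
  obtain ⟨e, hen, here, heim, hee⟩ := exists_circle_phi_eq hα₀ hα₁ hw
  obtain ⟨r, hzr, hr1⟩ := exists_between (mem_disk.1 hz)
  have hUd : Metric.ball (0 : ℂ) r ⊆ disk := Metric.ball_subset_ball hr1.le
  have hopen := isOpen_phi_image hs Metric.isOpen_ball hUd
  have hnear : ∀ᶠ x in 𝓝 e, phi α x ∈ phi α '' Metric.ball (0 : ℂ) r := by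
    refine (continuousAt_phi_of_ne α here heim).eventually_mem (hopen.mem_nhds ?_)
    exact ⟨z, by simpa using hzr, hee.symm⟩
  have hfar : ∀ᶠ x in 𝓝 e, r < ‖x‖ :=
    continuous_norm.continuousAt.eventually_const_lt (by simpa [hen] using hr1)
  have hfreq : ∃ᶠ x in 𝓝 e, x ∈ disk := by
    rw [← mem_closure_iff_frequently, disk, closure_ball _ one_ne_zero]
    simp [hen]
  obtain ⟨x, hxd, ⟨y, hy, hyx⟩, hx⟩ := (hfreq.and_eventually (hnear.and hfar)).exists
  have := injOn_phi hs (hUd hy) hxd hyx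
  subst this
  rw [mem_ball_zero_iff] at hy
  linarith

lemma horizontal_fourSlitDomain {α : ℝ} (hα₀ : 0 < α) (hα₁ : α < Real.pi / 2) (y : ℝ) :
    Convex ℝ (fourSlitDomain α ∩ {w : ℂ | w.im = y}) := by
  by_cases hy : |y| = slitHeight α
  · have : fourSlitDomain α ∩ {w : ℂ | w.im = y} =
        reLm ⁻¹' Set.Ioo (-slitTip α) (slitTip α) ∩ imLm ⁻¹' {y} := by
      ext w
      simp only [Set.mem_inter_iff, mem_fourSlitDomain hα₀ hα₁, Set.mem_ofPred_eq,
        Set.mem_preimage, Set.mem_singleton_iff, reLm_coe, imLm_coe, Set.mem_Ioo, ← abs_lt]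
      constructor
      · rintro ⟨h, rfl⟩
        exact ⟨by simpa [hy] using h, rfl⟩
      · rintro ⟨h, rfl⟩
        exact ⟨fun h' => absurd h'.2 (not_le.2 h), rfl⟩
    rw [this]
    exact ((convex_Ioo _ _).linear_preimage reLm).inter ((convex_singleton y).linear_preimage imLm)
  · have : fourSlitDomain α ∩ {w : ℂ | w.im = y} = imLm ⁻¹' {y} := by
      ext w
      simp only [Set.mem_inter_iff, mem_fourSlitDomain hα₀ hα₁, Set.mem_ofPred_eq,
        Set.mem_preimage, Set.mem_singleton_iff, imLm_coe]
      constructor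
      · exact fun h => h.2
      · rintro rfl
        exact ⟨fun h => hy h.1, rfl⟩
    rw [this]
    exact (convex_singleton y).linear_preimage imLm

lemma isOpen_fourSlitDomain {α : ℝ} (hα₀ : 0 < α) (hα₁ : α < Real.pi / 2) :
    IsOpen (fourSlitDomain α) := by
  have : fourSlitDomain α = ({w : ℂ | |w.im| = slitHeight α} ∩ {w : ℂ | slitTip α ≤ |w.re|})ᶜ := by
    ext w
    rw [mem_fourSlitDomain hα₀ hα₁]
    rfl
  rw [this, isOpen_compl_iff]
  exact (isClosed_eq (by fun_prop) (by fun_prop)).inter (isClosed_le (by fun_prop) (by fun_prop))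

lemma isConnected_fourSlitDomain {α : ℝ} (hα₀ : 0 < α) (hα₁ : α < Real.pi / 2) :
    IsConnected (fourSlitDomain α) := by
  have haxis : ∀ w : ℂ, w.re = 0 → w ∈ fourSlitDomain α := by
    intro w hw
    rw [mem_fourSlitDomain hα₀ hα₁, hw, abs_zero, not_and, not_le]
    exact fun _ => slitTip_pos hα₀ hα₁
  refine ⟨⟨0, haxis 0 rfl⟩, isPreconnected_of_forall 0 fun w hw => ?_⟩
  -- Since the tips have nonzero abscissa, the imaginary axis misses the slits; joined to the convex
  -- horizontal section through w, it connects 0 with w.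
  refine ⟨reLm ⁻¹' {0} ∪ (fourSlitDomain α ∩ {w' : ℂ | w'.im = w.im}), ?_, ?_, ?_, ?_⟩
  · exact Set.union_subset (fun x hx => haxis x hx) Set.inter_subset_left
  · exact Or.inl rfl
  · exact Or.inr ⟨hw, rfl⟩
  · refine IsPreconnected.union (w.im * I) ?_ ?_ ?_ ?_
    · simp
    · exact ⟨haxis _ (by simp), by simp⟩
    · exact ((convex_singleton (0 : ℝ)).linear_preimage reLm).isPreconnected
    · exact (horizontal_fourSlitDomain hα₀ hα₁ w.im).isPreconnected

lemma isCHDDomain_fourSlitDomain {α : ℝ} (hα₀ : 0 < α) (hα₁ : α < Real.pi / 2) :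
    IsCHDDomain (fourSlitDomain α) :=
  ⟨isOpen_fourSlitDomain hα₀ hα₁, isConnected_fourSlitDomain hα₀ hα₁,
    fun y => (horizontal_fourSlitDomain hα₀ hα₁ y).isPreconnected⟩

/-- By compactness, preimages accumulate at some z in the closed disk. On the circle, z = ±1 and z =
±i are excluded because φ would be unbounded there (sin α and cos α are nonzero), and any other z
yields a limit on a slit. -/
lemma closure_phi_image_inter_subset {α : ℝ} (hα₀ : 0 < α) (hα₁ : α < Real.pi / 2) :
    closure (phi α '' disk) ∩ fourSlitDomain α ⊆ phi α '' disk := by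
  have hs : 0 < Real.sin α := Real.sin_pos_of_pos_of_lt_pi hα₀ (by linarith [Real.pi_pos])
  have hc : 0 < Real.cos α := Real.cos_pos_of_mem_Ioo ⟨by linarith, hα₁⟩
  have hsC : (Real.sin α : ℂ) ≠ 0 := by exact_mod_cast hs.ne'
  have hcC : (Real.cos α : ℂ) ≠ 0 := by exact_mod_cast hc.ne'
  rintro w ⟨hw, hwΩ⟩
  obtain ⟨p, hp, hpw⟩ := mem_closure_iff_seq_limit.1 hw
  choose x hx hxp using hp
  obtain ⟨z, hz, k, hk, hlim⟩ := (isCompact_closedBall (0 : ℂ) 1).tendsto_subseq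
    (fun n => Metric.ball_subset_closedBall (hx n))
  have hphi : Tendsto (fun n => phi α (x (k n))) atTop (𝓝 w) := by
    simp only [hxp]
    exact hpw.comp hk.tendsto_atTop
  have hlim : Tendsto (fun n => x (k n)) atTop (𝓝 z) := hlim
  rw [mem_closedBall_zero_iff] at hz
  rcases hz.lt_or_eq with hz | hz
  · have hzd := mem_disk.2 hz
    exact ⟨z, hzd, tendsto_nhds_unique
      ((hasDerivAt_phi α hzd).continuousAt.tendsto.comp hlim) hphi⟩
  exfalso
  have hq : Tendsto (fun n => (x (k n)) ^ 2) atTop (𝓝 (z ^ 2)) := hlim.pow 2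
  by_cases him : z.im = 0
  · have hre : z.re ^ 2 = 1 := by
      have := Complex.sq_norm z
      rw [hz, normSq_apply, him] at this
      linarith
    have hz0 : 1 + z ^ 2 ≠ 0 := one_add_sq_ne_zero_of_re (by intro h; simp [h] at hre)
    have hL : Tendsto (fun n => log ((1 + x (k n)) / (1 - x (k n)))) atTop
        (𝓝 ((w - z * (Real.cos α : ℂ) ^ 2 / (1 + z ^ 2)) / (1 / 2 * (Real.sin α : ℂ) ^ 2))) := by
      have := (hphi.sub ((hlim.mul_const ((Real.cos α : ℂ) ^ 2)).div (hq.const_add 1) hz0)).div_const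
        (1 / 2 * (Real.sin α : ℂ) ^ 2)
      refine this.congr fun n => ?_
      simp only [phi, Pi.div_apply]
      rw [add_sub_cancel_right]
      field_simp
    set l := (w - z * (Real.cos α : ℂ) ^ 2 / (1 + z ^ 2)) / (1 / 2 * (Real.sin α : ℂ) ^ 2)
    -- The logarithm has a finite limit l, so 1 + z = (1 - z)eˡ in the limit; this reads 2 = 0 at z
    -- = 1 and 0 = 2eˡ at z = -1.
    have h1 : Tendsto (fun n => 1 + x (k n)) atTop (𝓝 ((1 - z) * exp l)) := by
      refine ((hlim.const_sub 1).mul hL.cexp).congr fun n => ?_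
      have h2 := one_sub_ne_zero (hx (k n))
      rw [exp_log (div_ne_zero (one_add_ne_zero (hx (k n))) h2)]
      field_simp
    have h2 := tendsto_nhds_unique (hlim.const_add 1) h1
    have hzre : z = z.re := by
      apply Complex.ext <;> simp [him]
    rcases sq_eq_one_iff.1 hre with h | h
    · rw [hzre, h] at h2
      norm_num at h2
    · rw [hzre, h] at h2
      norm_num at h2
  by_cases hre : z.re = 0
  · have hz2 : z ^ 2 = -1 := by
      have h3 := Complex.sq_norm z
      rw [hz, normSq_apply, hre] at h3
      apply Complex.ext <;> simp [sq, hre]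
      linarith
    have hQ : Tendsto (fun n => x (k n) * (Real.cos α : ℂ) ^ 2 / (1 + (x (k n)) ^ 2)) atTop
        (𝓝 (w - 1 / 2 * (Real.sin α : ℂ) ^ 2 * log ((1 + z) / (1 - z)))) := by
      have := hphi.sub (((continuousAt_log_cayley him).tendsto.comp hlim).const_mul
        (1 / 2 * (Real.sin α : ℂ) ^ 2))
      refine this.congr fun n => ?_
      simp [phi]
    -- Multiplying the convergent rational term by 1 + x², which tends to 0, forces z cos²α = 0.
    have h1 := (hQ.mul (hq.const_add 1)).congr (f₂ := fun n => x (k n) * (Real.cos α : ℂ) ^ 2)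
      fun n => by
        have := one_add_sq_ne_zero (hx (k n))
        field_simp
    have h2 := tendsto_nhds_unique (hlim.mul_const ((Real.cos α : ℂ) ^ 2)) h1
    rw [hz2, add_neg_cancel, mul_zero] at h2
    have hz0 : z ≠ 0 := by rintro rfl; simp at hz
    exact mul_ne_zero hz0 (pow_ne_zero 2 hcC) h2
  · have := tendsto_nhds_unique ((continuousAt_phi_of_ne α hre him).tendsto.comp hlim) hphi
    exact phi_circle_notMem hα₀ hα₁ hz hre him (this ▸ hwΩ)

lemma phi_image_disk {α : ℝ} (hα₀ : 0 < α) (hα₁ : α < Real.pi / 2) :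
    phi α '' disk = fourSlitDomain α := by
  have hs : 0 < Real.sin α := Real.sin_pos_of_pos_of_lt_pi hα₀ (by linarith [Real.pi_pos])
  have hsub : phi α '' disk ⊆ fourSlitDomain α := by
    rintro _ ⟨z, hz, rfl⟩
    exact phi_mem_fourSlitDomain hα₀ hα₁ hz
  refine hsub.antisymm ?_
  refine (isConnected_fourSlitDomain hα₀ hα₁).isPreconnected.subset_of_closure_inter_subset
    (isOpen_phi_image hs isOpen_disk subset_rfl) ?_ (closure_phi_image_inter_subset hα₀ hα₁)
  have h0 : (0 : ℂ) ∈ disk := by simp [mem_disk]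
  exact ⟨phi α 0, phi_mem_fourSlitDomain hα₀ hα₁ h0, 0, h0, rfl⟩

/-! ### The shear construction -/

section Shear

variable {h g : ℂ → ℂ}

lemma re_add_div_sub_pos {a b : ℂ} (hab : ‖b‖ < ‖a‖) : 0 < ((a + b) / (a - b)).re := by
  have ha : a ≠ 0 := by
    rintro rfl
    simp at hab
    linarith [norm_nonneg b]
  have h1 : b / a ∈ disk := by
    rw [mem_disk, norm_div, div_lt_one (norm_pos_iff.2 ha)]
    exact hab
  have h2 := re_cayley_pos h1
  have h3 : (1 + b / a) / (1 - b / a) = (a + b) / (a - b) := by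
    have : a - b ≠ 0 := by
      intro h
      rw [sub_eq_zero] at h
      rw [h] at hab
      exact lt_irrefl _ hab
    have := one_sub_ne_zero h1
    field_simp
  rwa [h3] at h2

lemma harmonicOnNhd_add_conj (hh : DifferentiableOn ℂ h disk) (hg : DifferentiableOn ℂ g disk) :
    InnerProductSpace.HarmonicOnNhd (fun z => h z + (starRingEnd ℂ) (g z)) disk := fun _ hz =>
  (hh.analyticAt (isOpen_disk.mem_nhds hz)).harmonicAt.add
    (hg.analyticAt (isOpen_disk.mem_nhds hz)).harmonicAt_conj

/-- The real differential v ↦ vh' + conj(vg') is injective when |g'| < |h'|, hence surjective in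
finite dimension, so the map is locally open. -/
lemma map_nhds_add_conj (hh : DifferentiableOn ℂ h disk) (hg : DifferentiableOn ℂ g disk)
    {z : ℂ} (hz : z ∈ disk) (hdil : ‖deriv g z‖ < ‖deriv h z‖) :
    map (fun z => h z + (starRingEnd ℂ) (g z)) (𝓝 z) = 𝓝 (h z + (starRingEnd ℂ) (g z)) := by
  have h1 := (hh.analyticAt (isOpen_disk.mem_nhds hz)).hasStrictDerivAt.hasStrictFDerivAt
    |>.restrictScalars ℝ
  have h2 := (hg.analyticAt (isOpen_disk.mem_nhds hz)).hasStrictDerivAt.hasStrictFDerivAt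
    |>.restrictScalars ℝ
  have h3 := h1.add ((conjCLE : ℂ →L[ℝ] ℂ).hasStrictFDerivAt.comp z h2)
  refine h3.map_nhds_eq_of_surj ?_
  rw [LinearMap.range_eq_top]
  refine LinearMap.injective_iff_surjective.1 ?_
  rw [injective_iff_map_eq_zero]
  intro v hv
  have hv' : v * deriv h z + (starRingEnd ℂ) (v * deriv g z) = 0 := by
    simpa using hv
  have h4 := congrArg norm (eq_neg_of_add_eq_zero_left hv')
  rw [norm_neg, RCLike.norm_conj, norm_mul, norm_mul] at h4
  by_contra hne
  have := mul_lt_mul_of_pos_left hdil (norm_pos_iff.2 hne)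
  linarith

/-- The shear construction of Clunie and Sheil-Small. -/
theorem isCHDMapping_of_shear (hh : DifferentiableOn ℂ h disk) (hg : DifferentiableOn ℂ g disk)
    (hdil : ∀ z ∈ disk, ‖deriv g z‖ < ‖deriv h z‖)
    (hinj : Set.InjOn (fun z => h z - g z) disk)
    (hΩ : IsCHDDomain ((fun z => h z - g z) '' disk)) :
    IsCHDMapping (fun z => h z + (starRingEnd ℂ) (g z)) := by
  set φ : ℂ → ℂ := fun z => h z - g z with hφ
  set f : ℂ → ℂ := fun z => h z + (starRingEnd ℂ) (g z) with hf
  set ψ : ℂ → ℂ := Function.invFunOn φ disk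
  have hh' : ∀ z ∈ disk, HasDerivAt h (deriv h z) z := fun z hz =>
    (hh.differentiableAt (isOpen_disk.mem_nhds hz)).hasDerivAt
  have hg' : ∀ z ∈ disk, HasDerivAt g (deriv g z) z := fun z hz =>
    (hg.differentiableAt (isOpen_disk.mem_nhds hz)).hasDerivAt
  have hφan : ∀ z ∈ disk, HasStrictDerivAt φ (deriv h z - deriv g z) z := fun z hz =>
    (hh.analyticAt (isOpen_disk.mem_nhds hz)).hasStrictDerivAt.sub
      (hg.analyticAt (isOpen_disk.mem_nhds hz)).hasStrictDerivAt
  have hφne : ∀ z ∈ disk, deriv h z - deriv g z ≠ 0 := by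
    intro z hz h0
    have := hdil z hz
    rw [sub_eq_zero.1 h0] at this
    exact lt_irrefl _ this
  have hψφ : ∀ z ∈ disk, ψ (φ z) = z := fun z hz => hinj.leftInvOn_invFunOn hz
  have hψmem : ∀ w ∈ φ '' disk, ψ w ∈ disk := fun w hw => Function.invFunOn_mem hw
  have hφψ : ∀ w ∈ φ '' disk, φ (ψ w) = w := fun w hw => Function.invFunOn_eq hw
  have hψcont : ∀ w ∈ φ '' disk, ContinuousAt ψ w := by
    rintro _ ⟨z, hz, rfl⟩
    -- As φ' ≠ 0, neighbourhoods of φ(z) are images of neighbourhoods of z, on which ψ∘φ is the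
    -- identity.
    rw [ContinuousAt, hψφ z hz, ← (hφan z hz).map_nhds_eq (hφne z hz), tendsto_map'_iff]
    refine tendsto_id.congr' ?_
    filter_upwards [isOpen_disk.mem_nhds hz] with x hx
    exact (hψφ x hx).symm
  have hψderiv : ∀ w ∈ φ '' disk,
      HasDerivAt ψ (deriv h (ψ w) - deriv g (ψ w))⁻¹ w := fun w hw =>
    HasDerivAt.of_local_left_inverse (hψcont w hw) (hφan _ (hψmem w hw)).hasDerivAt
      (hφne _ (hψmem w hw)) (Filter.eventually_of_mem (hΩ.isOpen.mem_nhds hw) hφψ)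
  have him : ∀ z, (f z).im = (φ z).im := by
    intro z
    simp [hf, hφ, sub_eq_add_neg]
  have hfcont : ContinuousOn f disk := hh.continuousOn.add
    (continuous_conj.comp_continuousOn hg.continuousOn)
  refine ⟨harmonicOnNhd_add_conj hh hg, ?_, ?_, ?_, ?_⟩
  · intro a ha b hb hab
    set y := (φ a).im with hy
    have hby : (φ b).im = y := by rw [← him, ← hab, him]
    set T : Set ℝ := re '' (φ '' disk ∩ {w : ℂ | w.im = y}) with hT
    have hTconv : Convex ℝ T := by
      rw [convex_iff_ordConnected]
      exact ((hΩ.horizontal y).image re continuous_re.continuousOn).ordConnected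
    have hTmem : ∀ t ∈ T, (t + y * I : ℂ) ∈ φ '' disk := by
      rintro _ ⟨w, ⟨hw, hwy⟩, rfl⟩
      rw [← (show w.im = y from hwy), re_add_im]
      exact hw
    -- Re f = Re(h + g), and (h + g)∘ψ has complex derivative (h' + g')/(h' - g').
    have hder : ∀ t ∈ T, ∃ d : ℝ, 0 < d ∧
        HasDerivAt (fun t : ℝ => (f (ψ (t + y * I))).re) d t := by
      intro t ht
      have hw := hTmem t ht
      have hz := hψmem _ hw
      have h1 : HasDerivAt (fun t : ℝ => (t : ℂ) + y * I) 1 t := by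
        simpa using (Complex.ofRealCLM.hasDerivAt (x := t)).add_const (y * I : ℂ)
      have h2 : HasDerivAt (fun w => h (ψ w) + g (ψ w)) _ ((t : ℂ) + y * I) :=
        ((hh' _ hz).add (hg' _ hz)).comp _ (hψderiv _ hw)
      have h3 := reCLM.hasFDerivAt.comp_hasDerivAt t
        (HasDerivAt.comp (h₂ := fun w => h (ψ w) + g (ψ w)) t h2 h1)
      refine ⟨_, ?_, h3.congr_of_eventuallyEq (.of_forall fun t => by simp [hf])⟩
      have := re_add_div_sub_pos (hdil _ hz)
      simpa [div_eq_mul_inv] using this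
    have hmono : StrictMonoOn (fun t : ℝ => (f (ψ (t + y * I))).re) T := by
      refine strictMonoOn_of_deriv_pos hTconv (fun t ht => ?_) fun t ht => ?_
      · obtain ⟨d, -, hd⟩ := hder t ht
        exact hd.continuousAt.continuousWithinAt
      · obtain ⟨d, hd0, hd⟩ := hder t (interior_subset ht)
        rwa [hd.deriv]
    have haT : (φ a).re ∈ T := ⟨φ a, ⟨⟨a, ha, rfl⟩, rfl⟩, rfl⟩
    have hbT : (φ b).re ∈ T := ⟨φ b, ⟨⟨b, hb, rfl⟩, hby⟩, rfl⟩
    have hea : ((φ a).re : ℂ) + y * I = φ a := re_add_im _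
    have heb : ((φ b).re : ℂ) + y * I = φ b := by rw [← hby, re_add_im]
    have hre := hmono.injOn haT hbT (by simp only [hea, heb, hψφ a ha, hψφ b hb, hab])
    exact hinj ha hb (Complex.ext hre hby.symm)
  · rw [isOpen_iff_mem_nhds]
    rintro _ ⟨z, hz, rfl⟩
    rw [hf, ← map_nhds_add_conj hh hg hz (hdil z hz)]
    exact image_mem_map (isOpen_disk.mem_nhds hz)
  · exact (Metric.isConnected_ball one_pos).image f hfcont
  · intro y
    -- Preservation of imaginary parts makes each section of the range the continuous image of the
    -- section of φ(disk) at the same height.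
    have : f '' disk ∩ {w : ℂ | w.im = y} =
        (f ∘ ψ) '' (φ '' disk ∩ {w : ℂ | w.im = y}) := by
      ext w
      constructor
      · rintro ⟨⟨z, hz, rfl⟩, hw⟩
        exact ⟨φ z, ⟨⟨z, hz, rfl⟩, (him z).symm.trans hw⟩, by simp [hψφ z hz]⟩
      · rintro ⟨_, ⟨⟨z, hz, rfl⟩, hw⟩, rfl⟩
        simp only [Function.comp_apply, hψφ z hz]
        exact ⟨⟨z, hz, rfl⟩, (him z).trans hw⟩
    rw [this]
    refine (hΩ.horizontal y).image _ (hfcont.comp (fun w hw => ?_) fun w hw => hψmem w hw.1)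
    exact (hψcont w hw.1).continuousWithinAt

end Shear

/-! ### The shear of φ_α with dilatation zⁿ -/

lemma hasDerivAt_I₁ {n : ℕ} (hn : 1 ≤ n) {z : ℂ} (hz : z ∈ disk) :
    HasDerivAt (I₁ n) (1 / ((1 - z ^ 2) * (1 - z ^ n))) z :=
  (hasDerivAt_I₁Closed hn hz).congr_of_eventuallyEq
    (Filter.eventually_of_mem (isOpen_disk.mem_nhds hz) fun _ hx => I₁_eq_closed hn hx)

lemma hasDerivAt_J {n : ℕ} (hn : 1 ≤ n) {η z : ℂ} (hη : ‖η‖ = 1) (hz : z ∈ disk) :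
    HasDerivAt (J n η) (1 / ((z - η) ^ 2 * (1 - z ^ n))) z :=
  (hasDerivAt_JClosed hn hη hz).congr_of_eventuallyEq
    (Filter.eventually_of_mem (isOpen_disk.mem_nhds hz) fun _ hx => J_eq_closed hn hη hx)

lemma hasDerivAt_analyticPart (α : ℝ) {n : ℕ} (hn : 1 ≤ n) {z : ℂ} (hz : z ∈ disk) :
    HasDerivAt (analyticPart α n) (phiDeriv α z / (1 - z ^ n)) z := by
  have := ((hasDerivAt_I₁ hn hz).const_mul ((Real.sin α : ℂ) ^ 2)).sub
    (((hasDerivAt_J hn (η := -I) (by simp) hz).add (hasDerivAt_J hn (η := I) (by simp) hz)).const_mul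
      ((Real.cos α : ℂ) ^ 2 / 2))
  convert! this using 1
  have h1 := one_sub_sq_ne_zero hz
  have h2 := one_sub_ne_zero (pow_mem_disk hz hn)
  have h3 : z - I ≠ 0 := fun h =>
    sub_ne_zero_of_mem_disk (w := I) (by simp) hz (by linear_combination -h)
  have h4 : z - -I ≠ 0 := fun h =>
    sub_ne_zero_of_mem_disk (w := -I) (by simp) hz (by linear_combination -h)
  have h5 : 1 + z ^ 2 = (z - I) * (z - -I) := by linear_combination I_sq
  -- The two double poles ±i recombine into the rational part of φ', which explains the coefficient
  -- -cos²α/2.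
  have h6 : 1 / ((z - -I) ^ 2 * (1 - z ^ n)) + 1 / ((z - I) ^ 2 * (1 - z ^ n)) =
      -2 * (1 - z ^ 2) / ((1 + z ^ 2) ^ 2 * (1 - z ^ n)) := by
    rw [h5]
    field_simp
    linear_combination 2 * I_sq
  have h7 := one_add_sq_ne_zero hz
  rw [h6]
  unfold phiDeriv
  field_simp
  ring

lemma hasDerivAt_coanalyticPart (α : ℝ) {n : ℕ} (hn : 1 ≤ n) {z : ℂ} (hz : z ∈ disk) :
    HasDerivAt (coanalyticPart α n) (z ^ n * (phiDeriv α z / (1 - z ^ n))) z := by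
  have := (hasDerivAt_analyticPart α hn hz).sub (hasDerivAt_phi α hz)
  convert! this using 1
  have h2 := one_sub_ne_zero (pow_mem_disk hz hn)
  field_simp
  ring

lemma isHarmonicShear_shearMap (α : ℝ) {n : ℕ} (hn : 1 ≤ n) :
    IsHarmonicShear (phi α) (fun z => z ^ n) (analyticPart α n) (coanalyticPart α n) where
  analytic_h _ hz := (hasDerivAt_analyticPart α hn hz).differentiableAt.differentiableWithinAt
  analytic_g _ hz := (hasDerivAt_coanalyticPart α hn hz).differentiableAt.differentiableWithinAt
  h_zero := by simp [analyticPart, I₁, I₂, I₃, J, integralFromZero]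
  g_zero := by simp [coanalyticPart, phi, analyticPart, I₁, I₂, I₃, J, integralFromZero]
  shear z hz := by
    rw [(hasDerivAt_analyticPart α hn hz).deriv, (hasDerivAt_coanalyticPart α hn hz).deriv,
      (hasDerivAt_phi α hz).deriv]
    have h2 := one_sub_ne_zero (pow_mem_disk hz hn)
    field_simp
  dilatation z hz := by
    rw [(hasDerivAt_analyticPart α hn hz).deriv, (hasDerivAt_coanalyticPart α hn hz).deriv,
      sub_self]

lemma isCHDMapping_shearMap {α : ℝ} (hα₀ : 0 < α) (hα₁ : α < Real.pi / 2) {n : ℕ} (hn : 1 ≤ n) :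
    IsCHDMapping (shearMap α n) := by
  have hs : 0 < Real.sin α := Real.sin_pos_of_pos_of_lt_pi hα₀ (by linarith [Real.pi_pos])
  have hsub : (fun z => analyticPart α n z - coanalyticPart α n z) = phi α := by
    funext z
    simp [coanalyticPart]
  refine isCHDMapping_of_shear (isHarmonicShear_shearMap α hn).analytic_h
    (isHarmonicShear_shearMap α hn).analytic_g (fun z hz => ?_) ?_ ?_
  · rw [(hasDerivAt_analyticPart α hn hz).deriv, (hasDerivAt_coanalyticPart α hn hz).deriv,
      norm_mul]
    refine mul_lt_of_lt_one_left (norm_pos_iff.2 (div_ne_zero (phiDeriv_ne_zero hs hz)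
      (one_sub_ne_zero (pow_mem_disk hz hn)))) ?_
    exact mem_disk.1 (pow_mem_disk hz hn)
  · rw [hsub]
    exact injOn_phi hs
  · rw [hsub, phi_image_disk hα₀ hα₁]
    exact isCHDDomain_fourSlitDomain hα₀ hα₁

end NehariShear

end

theorem mainTheorem2 (α : ℝ) (hα₀ : 0 < α) (hα₁ : α < Real.pi / 2) :
    (DifferentiableOn ℂ (NehariShear.phi α) NehariShear.disk ∧
      Set.InjOn (NehariShear.phi α) NehariShear.disk ∧
      NehariShear.phi α '' NehariShear.disk = NehariShear.fourSlitDomain α ∧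
      NehariShear.IsCHDDomain (NehariShear.fourSlitDomain α)) ∧
    ∀ n : ℕ, 1 ≤ n →
      (∀ z ∈ NehariShear.disk,
        NehariShear.I₁ n z = NehariShear.I₁Closed n z ∧
        NehariShear.I₂ n z = NehariShear.JClosed n (-Complex.I) z ∧
        NehariShear.I₃ n z = NehariShear.JClosed n Complex.I z) ∧
      NehariShear.IsHarmonicShear (NehariShear.phi α) (fun z => z ^ n)
        (NehariShear.analyticPart α n) (NehariShear.coanalyticPart α n) ∧
      NehariShear.IsCHDMapping (NehariShear.shearMap α n) := by
  have hs : 0 < Real.sin α := Real.sin_pos_of_pos_of_lt_pi hα₀ (by linarith [Real.pi_pos])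
  refine ⟨⟨NehariShear.differentiableOn_phi α, NehariShear.injOn_phi hs,
    NehariShear.phi_image_disk hα₀ hα₁, NehariShear.isCHDDomain_fourSlitDomain hα₀ hα₁⟩,
    fun n hn => ⟨fun z hz => ⟨NehariShear.I₁_eq_closed hn hz,
      NehariShear.J_eq_closed hn (by simp) hz, NehariShear.J_eq_closed hn (by simp) hz⟩,
      NehariShear.isHarmonicShear_shearMap α hn, NehariShear.isCHDMapping_shearMap hα₀ hα₁ hn⟩⟩
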